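/- Let $K=(K^1,K^2,K^3):\mathbb{R}^3\to\mathbb{R}^3$ be locally integrable, let $\varphi\ge 0$ be a smooth function on $\mathbb{R}^3$ supported in a ball centred at $0$ with $\int_{\mathbb{R}^3}\varphi(x)\,dx=1$, and put $K_\varphi^j(x)=\int_{\mathbb{R}^3}K^j(x-y)\varphi(y)\,dy$. Let $\nu\ge 0$ and let $B=(B^1,B^2,B^3)$ be a standard three-dimensional Brownian motion on a probability space $(\Omega,\mathcal{F},\mathbb{P})$. Let $x_n\in\mathbb{R}^3$ (loci) and $A_n(0)\in\mathbb{R}^3$ (initial vortices) be given, where $n$ runs through a finite index set. Consider the system $$dX_n^i(t)=-\sum_m\varepsilon^{ikj}A_m^k(t)K_\varphi^j(X_n(t)-X_m(t))\,dt+\sqrt{2\nu}\,dB^i(t),\qquad X_n(0)=x_n,$$ $$dA_n^i(t)=A_n^l(t)\sum_m\varepsilon^{ijk}\frac{\partial K_\varphi^j}{\partial x^l}(X_n(t)-X_m(t))A_m^k(t)\,dt,$$ with the given initial values $A_n(0)$, for $i=1,2,3$ (repeated indices $j,k,l$ are summed over $1,2,3$, and $\varepsilon^{ijk}$ is the Levi-Civita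 symbol). Then there is a unique maximal strong solution $(X_n,A_n)$, defined up to an explosion time $\tau$, with $\tau>0$ almost surely. That is, there are a stopping time $\tau$ and processes $X,A$, adapted to the filtration of $B$ augmented by the null events, whose paths are almost surely continuous on $[0,\tau)$ and satisfy the system there; almost surely on $\{\tau<\infty\}$ the point $(X(t),A(t))$ leaves every compact set as $t\uparrow\tau$; and if $(Y,C)$ is any solution of the system driven by $B$ up to a random time $\sigma$, with continuous paths on $[0,\sigma)$, then almost surely $\sigma\le\tau$ and $(Y,C)=(X,A)$ on $[0,\sigma)$. The vector fields $$W^i(x,t)=\sum_nA_n^i(t)\varphi(x-X_n(t)),\qquad V^i(x,t)=-\sum_n\varepsilon^{ikj}A_n^k(t)K_\varphi^j(x-X_n(t))$$ are $C^\infty$ in $x$ for $t<\tau$. Moreover, almost surely, $$\tau\ \ge\ \tau_{A(0),\varphi}:=\frac{1}{\|A(0)\|\,\|DK_\varphi\|_\infty},$$ where $\|A(0)\|=\sum_n|A_n(0)|$ and $\|DK_\varphi\|_\infty\in[0,\infty]$ is the $L^\infty$ norm of the operator norm of the derivative $DK_\varphi$. Here $1/0=\infty$, $1/\infty=0$, and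 the product is $0$ if $A(0)=0$. The number $\tau_{A(0),\varphi}$ is deterministic, and it is strictly positive whenever $\|DK_\varphi\|_\infty<\infty$. -/

import Mathlib

open MeasureTheory ProbabilityTheory Filter Topology
open scoped NNReal ENNReal

/-- Three-dimensional Euclidean space. -/
abbrev E3 : Type := EuclideanSpace ℝ (Fin 3)

/-- The Levi-Civita symbol `ε^{ijk}` (indices `0, 1, 2`). -/
def leviCivita (i j k : Fin 3) : ℝ :=
  if (i, j, k) = (0, 1, 2) ∨ (i, j, k) = (1, 2, 0) ∨ (i, j, k) = (2, 0, 1) then 1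
  else if (i, j, k) = (0, 2, 1) ∨ (i, j, k) = (2, 1, 0) ∨ (i, j, k) = (1, 0, 2) then -1
  else 0

/-- The mollified kernel `K_φ^j(x) = ∫ K^j(x - y) φ(y) dy`. -/
noncomputable def mollifiedKernel (K : E3 → E3) (φ : E3 → ℝ) (x : E3) : E3 :=
  WithLp.toLp 2 fun j => ∫ y, K (x - y) j * φ y

/-- The partial derivative `∂K_φ^j / ∂x^l` at `x`. -/
noncomputable def mollifiedKernelDeriv (K : E3 → E3) (φ : E3 → ℝ) (l j : Fin 3) (x : E3) : ℝ :=
  fderiv ℝ (mollifiedKernel K φ) x (EuclideanSpace.single l 1) j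

section Fields

variable {ι : Type*} [Fintype ι]

/-- `W^i(x) = ∑_n A_n^i φ(x - X_n)`, for loci `X` and vortices `A`. -/
noncomputable def vorticityField (φ : E3 → ℝ) (X A : ι → E3) (x : E3) : E3 :=
  WithLp.toLp 2 fun i => ∑ n, A n i * φ (x - X n)

/-- `V^i(x) = -∑_n ε^{ikj} A_n^k K_φ^j(x - X_n)`, for loci `X` and vortices `A`. -/
noncomputable def velocityField (K : E3 → E3) (φ : E3 → ℝ) (X A : ι → E3) (x : E3) : E3 :=
  WithLp.toLp 2 fun i =>
    -∑ n, ∑ k, ∑ j, leviCivita i k j * A n k * mollifiedKernel K φ (x - X n) j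

/-- The right-hand side `A_n^l ∑_m ε^{ijk} ∂_l K_φ^j(X_n - X_m) A_m^k` of the equation for the
`n`-th vortex. -/
noncomputable def stretching (K : E3 → E3) (φ : E3 → ℝ) (X A : ι → E3) (n : ι) : E3 :=
  WithLp.toLp 2 fun i =>
    ∑ l, A n l * ∑ m, ∑ j, ∑ k,
      leviCivita i j k * mollifiedKernelDeriv K φ l j (X n - X m) * A m k

/-- The paths `X, A` solve, on the time interval `[0, T)`, the random vortex system
`dX_n = V(X_n(t), t) dt + √(2ν) dB(t)`, `X_n(0) = x_n`, and
`dA_n^i = A_n^l ∑_m ε^{ijk} ∂_l K_φ^j(X_n - X_m) A_m^k dt`, `A_n(0) = a_n`,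
driven by the path `b` of `B`. The noise is additive, so the stochastic integral
`∫_0^t √(2ν) dB` is `√(2ν) (B(t) - B(0))`. -/
structure IsVortexPath (K : E3 → E3) (φ : E3 → ℝ) (ν : ℝ) (x a : ι → E3) (b : ℝ≥0 → E3)
    (T : ℝ≥0∞) (X A : ℝ≥0 → ι → E3) : Prop where
  continuousOn_loci : ContinuousOn X {t : ℝ≥0 | (t : ℝ≥0∞) < T}
  continuousOn_vortices : ContinuousOn A {t : ℝ≥0 | (t : ℝ≥0∞) < T}
  loci_eq : ∀ t : ℝ≥0, (t : ℝ≥0∞) < T → ∀ n,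
    X t n = x n
      + (∫ s in (0 : ℝ)..t, velocityField K φ (X s.toNNReal) (A s.toNNReal) (X s.toNNReal n))
      + √(2 * ν) • (b t - b 0)
  vortices_eq : ∀ t : ℝ≥0, (t : ℝ≥0∞) < T → ∀ n,
    A t n = a n + ∫ s in (0 : ℝ)..t, stretching K φ (X s.toNNReal) (A s.toNNReal) n

end Fields

section Probability

variable {Ω : Type*} {mΩ : MeasurableSpace Ω}

/-- `B` is a standard three-dimensional Brownian motion: its components are independent
standard real Brownian motions. -/
structure IsBrownian3 (B : ℝ≥0 → Ω → E3) (P : Measure Ω) : Prop where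
  measurable : ∀ t, Measurable (B t)
  brownian : ∀ i, IsBrownianReal (fun t ω => B t ω i) P
  indep : iIndepFun (fun i ω (t : ℝ≥0) => B t ω i) P

/-- The augmented filtration of `B`: at time `t`, the σ-algebra generated by `B s`, `s ≤ t`, and
by the `P`-null events. -/
def brownianFiltration (B : ℝ≥0 → Ω → E3) (P : Measure Ω) (hB : ∀ t, Measurable (B t)) :
    Filtration ℝ≥0 mΩ where
  seq t := (⨆ s ≤ t, MeasurableSpace.comap (B s) inferInstance) ⊔
    MeasurableSpace.generateFrom {N | MeasurableSet N ∧ P N = 0}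
  mono' _ _ h := sup_le_sup_right (biSup_mono fun _ hs => hs.trans h) _
  le' _ := sup_le (iSup₂_le fun s _ => (hB s).comap_le)
    (MeasurableSpace.generateFrom_le fun _ hN => hN.1)

variable {ι : Type*} [Fintype ι]

/-- `(X, A)` is a strong solution of the random vortex system up to the random time `τ`: `τ` is a
stopping time and `X, A` are adapted for the augmented filtration of the driving Brownian motion,
and almost surely the paths are continuous and solve the system on `[0, τ)`. The values of
`X, A` from `τ` on play no role. -/
structure IsStrongVortexSolution (K : E3 → E3) (φ : E3 → ℝ) (ν : ℝ) (x a : ι → E3)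
    (B : ℝ≥0 → Ω → E3) (P : Measure Ω) (hB : IsBrownian3 B P)
    (τ : Ω → ℝ≥0∞) (X A : ℝ≥0 → Ω → ι → E3) : Prop where
  isStoppingTime : IsStoppingTime (brownianFiltration B P hB.measurable) τ
  adapted_loci : Adapted (brownianFiltration B P hB.measurable) X
  adapted_vortices : Adapted (brownianFiltration B P hB.measurable) A
  isVortexPath : ∀ᵐ ω ∂P, IsVortexPath K φ ν x a (fun t => B t ω) (τ ω)
    (fun t => X t ω) (fun t => A t ω)

end Probability

/-- `τ_{A(0),φ} = 1 / (‖A(0)‖ ‖DK_φ‖_∞)` in `[0, ∞]`, where `‖A(0)‖ = ∑_n |a_n|` and `‖DK_φ‖_∞` is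
the `L^∞` norm of the operator norm of the derivative; `1 / 0 = ∞` and `1 / ∞ = 0`, and the product
is `0` when `A(0) = 0`. -/
noncomputable def explosionBound {ι : Type*} [Fintype ι] (K : E3 → E3) (φ : E3 → ℝ)
    (a : ι → E3) : ℝ≥0∞ :=
  1 / (ENNReal.ofReal (∑ n, ‖a n‖) * eLpNorm (fderiv ℝ (mollifiedKernel K φ)) ⊤ volume)

/-! The noise is additive, so for a fixed Brownian path the system is a deterministic integral
equation `u(t) = g(t) + ∫₀ᵗ F(u)` on a finite-dimensional phase space. Here `g` is the continuous
path of initial values plus noise. The drift `F` is smooth because `K_φ` is a convolution of a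
locally integrable kernel with a smooth compactly supported function. No stochastic calculus is
needed.

Multiplying `F` by bump functions gives bounded Lipschitz fields `Fn`. Their equations have global
solutions as limits of Picard iterates, unique by Gronwall. Cut-off solutions agree as long as they
stay in the balls where the fields do, and together they form the maximal path. Each Picard iterate
at time `s` depends measurably on the forcing up to `s`, so the limits are adapted and the explosion
time is a stopping time. Blow-up at a finite explosion time `T` holds because shortly before `T`
neither the forcing nor a bounded drift can carry the path from radius `n` to `n + 1`
(`IsCutoff.tendsto_norm_maximalPath`).

For the lower bound, `|u × v| ≤ |u||v|` shows that `h = ∑ |A_n|` satisfies `h ≤ c + D ∫ h²` with `c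
= ‖A(0)‖` and `D = ‖DK_φ‖_∞`. Comparison with `y' = D y²` keeps `h` bounded on `[0, T]` whenever `D
c T < 1` (`sum_norm_vortices_le`). The velocity then grows at most linearly in the loci, which
Gronwall bounds too (`norm_loci_le`), so explosion at such a `T` is impossible. -/

/-! ### Integral equations with continuous forcing: uniqueness and Picard iteration -/

section IntegralEquation

variable {V : Type*} [NormedAddCommGroup V] [NormedSpace ℝ V]

/-- The path `u` solves `u(s) = g(s) + ∫₀ˢ F(u(r)) dr` for `s ≤ t`, continuously. -/
structure SolvesTo (F : V → V) (g : ℝ≥0 → V) (t : ℝ≥0) (u : ℝ≥0 → V) : Prop where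
  continuousOn : ContinuousOn u (Set.Iic t)
  eq : ∀ s ≤ t, u s = g s + ∫ r in (0 : ℝ)..s, F (u r.toNNReal)

theorem toNNReal_le_of_mem_uIcc {s : ℝ≥0} {r : ℝ} (hr : r ∈ Set.uIcc (0 : ℝ) s) :
    r.toNNReal ≤ s := by
  rw [Set.uIcc_of_le s.coe_nonneg] at hr
  exact Real.toNNReal_le_iff_le_coe.2 hr.2

theorem integral_congr_path {W : Type*} [NormedAddCommGroup W] [NormedSpace ℝ W]
    {p q : ℝ≥0 → W} {s : ℝ≥0} (h : ∀ r ≤ s, p r = q r) :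
    ∫ r in (0 : ℝ)..s, p r.toNNReal = ∫ r in (0 : ℝ)..s, q r.toNNReal :=
  intervalIntegral.integral_congr fun _ hr => h _ (toNNReal_le_of_mem_uIcc hr)

/-- Freezing a path after time `t` makes it continuous everywhere, as the comparison lemmas below
require. -/
theorem ContinuousOn.comp_min {W : Type*} [TopologicalSpace W] {u : ℝ≥0 → W} {t : ℝ≥0}
    (h : ContinuousOn u (Set.Iic t)) : Continuous fun s => u (min s t) :=
  h.comp_continuous (by fun_prop) fun s => min_le_right s t

theorem ContinuousOn.intervalIntegrable_path {W : Type*} [NormedAddCommGroup W] {p : ℝ≥0 → W}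
    {s t : ℝ≥0} (h : ContinuousOn p (Set.Iic t)) (hs : s ≤ t) :
    IntervalIntegrable (fun r : ℝ => p r.toNNReal) volume 0 s :=
  ContinuousOn.intervalIntegrable <| h.comp continuous_real_toNNReal.continuousOn
    fun _ hr => (toNNReal_le_of_mem_uIcc hr).trans hs

namespace SolvesTo

variable {F G : V → V} {g : ℝ≥0 → V} {t : ℝ≥0} {u v : ℝ≥0 → V}

theorem congr (h : SolvesTo F g t u) (huv : ∀ s ≤ t, u s = v s) : SolvesTo F g t v := by
  refine ⟨h.continuousOn.congr fun s hs => (huv s hs).symm, fun s hs => ?_⟩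
  rw [← huv s hs, h.eq s hs, integral_congr_path (p := fun r => F (u r)) (q := fun r => F (v r))]
  exact fun r hr => by rw [huv r (hr.trans hs)]

theorem congr_field (h : SolvesTo F g t u) (hFG : ∀ s ≤ t, F (u s) = G (u s)) :
    SolvesTo G g t u := by
  refine ⟨h.continuousOn, fun s hs => ?_⟩
  rw [h.eq s hs, integral_congr_path (p := fun r => F (u r)) (q := fun r => G (u r))]
  exact fun r hr => hFG r (hr.trans hs)

end SolvesTo

/-- Gronwall's inequality in integral form. -/
theorem le_mul_exp_of_le_integral {h : ℝ → ℝ} {C L T : ℝ} (hL : 0 ≤ L) (hc : Continuous h)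
    (hle : ∀ t ∈ Set.Icc 0 T, h t ≤ C + L * ∫ s in (0 : ℝ)..t, h s) :
    ∀ t ∈ Set.Icc 0 T, h t ≤ C * Real.exp (L * t) := by
  intro t ht
  set H : ℝ → ℝ := fun t => C + L * ∫ s in (0 : ℝ)..t, h s with hH
  have hd : ∀ s, HasDerivAt H (L * h s) s := fun s =>
    ((hc.integral_hasStrictDerivAt 0 s).hasDerivAt.const_mul L).const_add C
  -- The hypothesis says `H' = L h ≤ L H`, so `H e^{-Ls}` cannot increase.
  have hanti : AntitoneOn (fun s => H s * Real.exp (-(L * s))) (Set.Icc 0 T) := by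
    have hd' : ∀ s, HasDerivAt (fun s => H s * Real.exp (-(L * s)))
        (L * h s * Real.exp (-(L * s)) + H s * (Real.exp (-(L * s)) * -(L * 1))) s := fun s =>
      (hd s).mul (((hasDerivAt_id s).const_mul L).neg.exp)
    refine antitoneOn_of_deriv_nonpos (convex_Icc 0 T)
      (fun s _ => (hd' s).continuousAt.continuousWithinAt)
      (fun s _ => (hd' s).differentiableAt.differentiableWithinAt) fun s hs => ?_
    rw [(hd' s).deriv]
    have h1 := hle s (interior_subset hs)
    have h2 : 0 ≤ L * Real.exp (-(L * s)) * (H s - h s) :=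
      mul_nonneg (mul_nonneg hL (Real.exp_pos _).le) (sub_nonneg.2 h1)
    linarith
  have h0 := hanti ⟨le_rfl, ht.1.trans ht.2⟩ ht ht.1
  have h1 : H t * Real.exp (-(L * t)) ≤ C := by simpa [hH] using h0
  refine (hle t ht).trans ?_
  rw [Real.exp_neg, ← div_eq_mul_inv, div_le_iff₀ (Real.exp_pos _)] at h1
  exact h1

/-- The forcing cancels in `u - v`, and Gronwall with `C = 0` forces the difference to vanish. -/
theorem SolvesTo.eq_of_lipschitz {F : V → V} {g : ℝ≥0 → V} {t : ℝ≥0} {u v : ℝ≥0 → V} {L : ℝ≥0}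
    (hF : LipschitzWith L F) (hu : SolvesTo F g t u) (hv : SolvesTo F g t v) :
    ∀ s ≤ t, u s = v s := by
  set h : ℝ≥0 → ℝ := fun s => ‖u s - v s‖
  have hhc : ContinuousOn h (Set.Iic t) := (hu.continuousOn.sub hv.continuousOn).norm
  have key := le_mul_exp_of_le_integral (h := fun r : ℝ => h (min r.toNNReal t)) (C := 0)
    (L := L) (T := t) L.2 (hhc.comp_min.comp continuous_real_toNNReal) (by
      rintro r ⟨hr0, hrt⟩
      lift r to ℝ≥0 using hr0
      have hrt : r ≤ t := by exact_mod_cast hrt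
      have hint : ∫ s in (0 : ℝ)..r, h (min s.toNNReal t) = ∫ s in (0 : ℝ)..r, h s.toNNReal :=
        integral_congr_path (p := fun s => h (min s t)) (q := h)
          fun s hs => by rw [min_eq_left (hs.trans hrt)]
      have hFu := (hF.continuous.comp_continuousOn hu.continuousOn).intervalIntegrable_path hrt
      have hFv := (hF.continuous.comp_continuousOn hv.continuousOn).intervalIntegrable_path hrt
      simp only [Function.comp_apply] at hFu hFv
      rw [Real.toNNReal_coe, min_eq_left hrt, hint, zero_add,
        ← intervalIntegral.integral_const_mul]
      simp only [h]
      rw [hu.eq r hrt, hv.eq r hrt, add_sub_add_left_eq_sub,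
        ← intervalIntegral.integral_sub hFu hFv]
      refine intervalIntegral.norm_integral_le_of_norm_le r.2 (ae_of_all _ fun s hs => ?_) ?_
      · simpa [dist_eq_norm] using hF.dist_le_mul (u s.toNNReal) (v s.toNNReal)
      · exact (hhc.intervalIntegrable_path hrt).const_mul _)
  intro s hs
  have := key s ⟨s.2, by exact_mod_cast hs⟩
  simp only [Real.toNNReal_coe, min_eq_left hs, zero_mul, h] at this
  exact sub_eq_zero.1 (norm_le_zero_iff.1 this)

/-- The Picard iterates for `u(t) = g(t) + ∫₀ᵗ F(u(s)) ds`. -/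
noncomputable def picardIterate (F : V → V) (g : ℝ≥0 → V) : ℕ → ℝ≥0 → V
  | 0 => g
  | k + 1 => fun t => g t + ∫ r in (0 : ℝ)..t, F (picardIterate F g k r.toNNReal)

/-- The pointwise limit of the Picard iterates. -/
noncomputable def picardLimit (F : V → V) (g : ℝ≥0 → V) (t : ℝ≥0) : V :=
  limUnder atTop fun k => picardIterate F g k t

section Picard

variable {F : V → V} {g : ℝ≥0 → V}

theorem continuous_picardIterate (hF : Continuous F) (hg : Continuous g) (k : ℕ) :
    Continuous (picardIterate F g k) := by
  induction k with
  | zero => exact hg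
  | succ k ih =>
    refine hg.add ((intervalIntegral.continuous_primitive (fun a b => ?_) 0).comp
      NNReal.continuous_coe)
    exact (hF.comp (ih.comp continuous_real_toNNReal)).intervalIntegrable a b

/-- With the weight `exp (2 (L + 1) s)`, integration gains a factor `1 / (2 (L + 1))`, which beats
the Lipschitz constant and halves the distance at every step. Using `L + 1` avoids dividing by zero
when `L = 0`. -/
theorem dist_picardIterate_le {L : ℝ≥0} {M : ℝ} (hF : LipschitzWith L F) (hM : ∀ z, ‖F z‖ ≤ M)
    (hg : Continuous g) (t : ℝ≥0) (k : ℕ) : ∀ s ≤ t,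
    dist (picardIterate F g k s) (picardIterate F g (k + 1) s) ≤
      M * t * Real.exp (2 * (L + 1) * s) / 2 ^ k := by
  have hM0 : 0 ≤ M := (norm_nonneg _).trans (hM 0)
  induction k with
  | zero =>
    intro s hs
    have h1 : ‖∫ r in (0 : ℝ)..s, F (picardIterate F g 0 r.toNNReal)‖ ≤ M * |(s : ℝ) - 0| :=
      intervalIntegral.norm_integral_le_of_norm_le_const fun r _ => hM _
    simp only [picardIterate, dist_self_add_right, pow_zero, div_one] at h1 ⊢
    refine h1.trans ?_
    rw [sub_zero, abs_of_nonneg s.coe_nonneg]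
    have h2 : (s : ℝ) ≤ t := by exact_mod_cast hs
    have h3 : (1 : ℝ) ≤ Real.exp (2 * (L + 1) * s) := Real.one_le_exp (by positivity)
    calc M * s ≤ M * t * 1 := by rw [mul_one]; gcongr
      _ ≤ _ := by gcongr
  | succ k ih =>
    intro s hs
    have hi : ∀ j, IntervalIntegrable (fun r : ℝ => F (picardIterate F g j r.toNNReal)) volume 0 s :=
      fun j => (hF.continuous.comp
      (continuous_picardIterate hF.continuous hg j)).continuousOn.intervalIntegrable_path
        (le_refl s)
    change dist (g s + _) (g s + _) ≤ _
    rw [dist_add_left, dist_eq_norm, ← intervalIntegral.integral_sub (hi _) (hi _)]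
    set c : ℝ := L + 1
    have hc : 0 < c := by positivity
    have hd : ∀ r : ℝ, HasDerivAt (fun r => M * t / 2 ^ (k + 1) * Real.exp (2 * c * r))
        (c * (M * t * Real.exp (2 * c * r) / 2 ^ k)) r := fun r => by
      refine ((((hasDerivAt_id r).const_mul (2 * c)).exp).const_mul
        (M * t / 2 ^ (k + 1))).congr_deriv ?_
      rw [pow_succ]
      simp only [id]
      field_simp
    have hcont : Continuous fun r : ℝ => c * (M * t * Real.exp (2 * c * r) / 2 ^ k) := by fun_prop
    have hle : ‖∫ r in (0 : ℝ)..s, F (picardIterate F g k r.toNNReal)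
          - F (picardIterate F g (k + 1) r.toNNReal)‖
        ≤ ∫ r in (0 : ℝ)..s, c * (M * t * Real.exp (2 * c * r) / 2 ^ k) := by
      refine intervalIntegral.norm_integral_le_of_norm_le s.2 (ae_of_all _ fun r hr => ?_)
        (hcont.intervalIntegrable _ _)
      rw [← dist_eq_norm]
      refine (hF.dist_le_mul _ _).trans ?_
      have := ih r.toNNReal ((Real.toNNReal_le_iff_le_coe.2 hr.2).trans hs)
      rw [Real.coe_toNNReal _ hr.1.le] at this
      have hLc : (L : ℝ) ≤ c := by simp [c]
      exact mul_le_mul hLc this dist_nonneg hc.le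
    rw [intervalIntegral.integral_eq_sub_of_hasDerivAt (fun r _ => hd r)
      (hcont.intervalIntegrable _ _)] at hle
    refine hle.trans ?_
    have : 0 ≤ M * t / 2 ^ (k + 1) * Real.exp (2 * c * 0) := by positivity
    have h2 : M * t / 2 ^ (k + 1) * Real.exp (2 * c * s)
      = M * t * Real.exp (2 * c * s) / 2 ^ (k + 1) := by ring
    linarith

/-- Only the forcing up to time `t` is assumed measurable; taking for `m` the σ-algebra of time `t`
in a filtration, this yields adaptedness. -/
theorem measurable_picardIterate [MeasurableSpace V] [BorelSpace V]
    [SecondCountableTopology V] {Ω : Type*} {t : ℝ≥0} (hF : Continuous F) {m : MeasurableSpace Ω} {g : Ω → ℝ≥0 → V}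
    (hgc : ∀ ω, Continuous (g ω)) (hgm : ∀ s ≤ t, Measurable fun ω => g ω s) (k : ℕ) :
    ∀ s ≤ t, Measurable fun ω => picardIterate F (g ω) k s := by
  induction k with
  | zero => exact hgm
  | succ k ih =>
    intro s hs
    refine (hgm s hs).add ?_
    -- Continuity in `r` and measurability in `ω` give joint measurability. The truncation at `s`
    -- keeps `r` in the range of the induction hypothesis.
    have h1 : StronglyMeasurable (Function.uncurry fun (r : ℝ) (ω : Ω) =>
        F (picardIterate F (g ω) k (min r.toNNReal s))) :=
      stronglyMeasurable_uncurry_of_continuous_of_stronglyMeasurable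
        (fun ω => hF.comp ((continuous_picardIterate hF (hgc ω) k).comp (by fun_prop)))
        fun r => (hF.measurable.comp (ih _ ((min_le_right _ _).trans hs))).stronglyMeasurable
    have h2 : ∀ ω, ∫ r in (0 : ℝ)..s, F (picardIterate F (g ω) k r.toNNReal) =
        ∫ r in Set.Ioc (0 : ℝ) s, F (picardIterate F (g ω) k (min r.toNNReal s)) := fun ω => by
      rw [← intervalIntegral.integral_of_le s.coe_nonneg]
      refine integral_congr_path (p := fun r => F (picardIterate F (g ω) k r))
        (q := fun r => F (picardIterate F (g ω) k (min r s))) fun r hr => ?_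
      rw [min_eq_left hr]
    simp only [h2]
    exact h1.integral_prod_left.measurable

variable [CompleteSpace V]

theorem tendsto_picardIterate {L : ℝ≥0} {M : ℝ} (hF : LipschitzWith L F) (hM : ∀ z, ‖F z‖ ≤ M)
    (hg : Continuous g) (t : ℝ≥0) :
    Tendsto (fun k => picardIterate F g k t) atTop (𝓝 (picardLimit F g t)) := by
  refine CauchySeq.tendsto_limUnder (cauchySeq_of_le_geometric_two
    (C := 2 * (M * t * Real.exp (2 * (L + 1) * t))) fun k => ?_)
  convert dist_picardIterate_le hF hM hg t k t le_rfl using 1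
  ring

theorem solvesTo_picardLimit {L : ℝ≥0} {M : ℝ} (hF : LipschitzWith L F) (hM : ∀ z, ‖F z‖ ≤ M)
    (hg : Continuous g) (t : ℝ≥0) : SolvesTo F g t (picardLimit F g) := by
  have hlim := tendsto_picardIterate hF hM hg
  have hlimF : ∀ r : ℝ, Tendsto (fun k => F (picardIterate F g k r.toNNReal)) atTop
      (𝓝 (F (picardLimit F g r.toNNReal))) :=
    fun r => (hF.continuous.tendsto _).comp (hlim _)
  have hcont : ∀ k, Continuous fun r : ℝ => F (picardIterate F g k r.toNNReal) := fun k =>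
    hF.continuous.comp
      ((continuous_picardIterate hF.continuous hg k).comp continuous_real_toNNReal)
  -- At this stage the limit is only known pointwise. Measurability and the bound `M` suffice to
  -- integrate it; continuity then follows from the integral equation.
  have hmeas : StronglyMeasurable fun r : ℝ => F (picardLimit F g r.toNNReal) :=
    stronglyMeasurable_of_tendsto atTop (fun k => (hcont k).stronglyMeasurable)
      (tendsto_pi_nhds.2 hlimF)
  have heq : ∀ s, picardLimit F g s = g s + ∫ r in (0 : ℝ)..s, F (picardLimit F g r.toNNReal) := by
    intro s
    refine tendsto_nhds_unique ((tendsto_add_atTop_iff_nat 1).2 (hlim s)) ?_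
    refine Tendsto.const_add _ ?_
    exact intervalIntegral.tendsto_integral_filter_of_dominated_convergence (fun _ => M)
      (Eventually.of_forall fun k => (hcont k).aestronglyMeasurable)
      (Eventually.of_forall fun k => ae_of_all _ fun r _ => hM _)
      intervalIntegrable_const (ae_of_all _ fun r _ => hlimF r)
  refine ⟨Continuous.continuousOn ?_, fun s _ => heq s⟩
  rw [funext heq]
  refine hg.add ((intervalIntegral.continuous_primitive (fun a b => ?_) 0).comp
    NNReal.continuous_coe)
  exact (intervalIntegrable_const (c := M)).mono_fun hmeas.aestronglyMeasurable
    (ae_of_all _ fun r => (hM _).trans (le_abs_self M))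

theorem continuous_picardLimit {L : ℝ≥0} {M : ℝ} (hF : LipschitzWith L F) (hM : ∀ z, ‖F z‖ ≤ M)
    (hg : Continuous g) : Continuous (picardLimit F g) :=
  continuous_iff_continuousAt.2 fun t =>
    (solvesTo_picardLimit hF hM hg (t + 1)).continuousOn.continuousAt
      (Iic_mem_nhds (lt_add_one t))

end Picard

end IntegralEquation

/-! ### Maximal solutions by cut-off, and their blow-up -/

section MaximalSolution

variable {V : Type*} [NormedAddCommGroup V] [NormedSpace ℝ V]

/-- The fields `Fn n` are bounded, globally Lipschitz, and agree with `F` on the closed ball of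
radius `n + 1`. -/
structure IsCutoff (F : V → V) (Fn : ℕ → V → V) : Prop where
  lipschitz : ∀ n, ∃ L, LipschitzWith L (Fn n)
  bounded : ∀ n, ∃ M, ∀ z, ‖Fn n z‖ ≤ M
  eq : ∀ (n : ℕ) z, ‖z‖ ≤ n + 1 → Fn n z = F z

/-- A bump function times a `C¹` field is `C¹` with compact support, hence bounded and globally
Lipschitz. -/
theorem exists_isCutoff [FiniteDimensional ℝ V] {F : V → V} (hF : ContDiff ℝ 1 F) :
    ∃ Fn, IsCutoff F Fn := by
  let χ : ℕ → ContDiffBump (0 : V) := fun n =>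
    { rIn := n + 1, rOut := n + 2, rIn_pos := by positivity, rIn_lt_rOut := by linarith }
  have hc : ∀ n, ContDiff ℝ 1 fun z => χ n z • F z := fun n => (χ n).contDiff.smul hF
  have hs : ∀ n, HasCompactSupport fun z => χ n z • F z := fun n =>
    (χ n).hasCompactSupport.smul_right
  refine ⟨fun n z => χ n z • F z, fun n => ?_, fun n => ?_, fun n z hz => ?_⟩
  · exact (hc n).lipschitzWith_of_hasCompactSupport (hs n) one_ne_zero
  · exact (hs n).exists_bound_of_continuous (hc n).continuous
  · rw [(χ n).one_of_mem_closedBall (by simpa [χ] using hz), one_smul]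

/-- The `n`-th cut-off solution stays in the ball of radius `n` up to time `t`. -/
def CutoffBounded (Fn : ℕ → V → V) (g : ℝ≥0 → V) (n : ℕ) (t : ℝ≥0) : Prop :=
  ∀ s ≤ t, ‖picardLimit (Fn n) g s‖ ≤ n

/-- The explosion time of the maximal solution. -/
noncomputable def explosionTime (Fn : ℕ → V → V) (g : ℝ≥0 → V) : ℝ≥0∞ :=
  ⨆ (t : ℝ≥0) (_ : ∃ n, CutoffBounded Fn g n t), (t : ℝ≥0∞)

/-- The maximal solution, as the limit of the cut-off solutions. -/
noncomputable def maximalPath (Fn : ℕ → V → V) (g : ℝ≥0 → V) (t : ℝ≥0) : V :=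
  limUnder atTop fun n => picardLimit (Fn n) g t

variable [CompleteSpace V] {F : V → V} {Fn : ℕ → V → V} {g : ℝ≥0 → V} {t : ℝ≥0}

namespace IsCutoff

theorem solvesTo (hc : IsCutoff F Fn) (hg : Continuous g) (n : ℕ) (t : ℝ≥0) :
    SolvesTo (Fn n) g t (picardLimit (Fn n) g) := by
  obtain ⟨L, hL⟩ := hc.lipschitz n
  obtain ⟨M, hM⟩ := hc.bounded n
  exact solvesTo_picardLimit hL hM hg t

theorem continuous (hc : IsCutoff F Fn) (hg : Continuous g) (n : ℕ) :
    Continuous (picardLimit (Fn n) g) := by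
  obtain ⟨L, hL⟩ := hc.lipschitz n
  obtain ⟨M, hM⟩ := hc.bounded n
  exact continuous_picardLimit hL hM hg

/-- In the ball of radius `n + 1` the solution cannot distinguish `F` from `Fn n`, so uniqueness for
the Lipschitz field applies. -/
theorem eq_picardLimit (hc : IsCutoff F Fn) (hg : Continuous g) {u : ℝ≥0 → V} {n : ℕ}
    (hu : SolvesTo F g t u) (hb : ∀ s ≤ t, ‖u s‖ ≤ n + 1) :
    ∀ s ≤ t, u s = picardLimit (Fn n) g s := by
  obtain ⟨L, hL⟩ := hc.lipschitz n
  exact (hu.congr_field fun s hs => (hc.eq n _ (hb s hs)).symm).eq_of_lipschitz hL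
    (hc.solvesTo hg n t)

theorem solvesTo_of_norm_le (hc : IsCutoff F Fn) (hg : Continuous g) {n : ℕ}
    (hb : ∀ s ≤ t, ‖picardLimit (Fn n) g s‖ ≤ n + 1) :
    SolvesTo F g t (picardLimit (Fn n) g) :=
  (hc.solvesTo hg n t).congr_field fun s hs => hc.eq n _ (hb s hs)

theorem picardLimit_eq_of_le (hc : IsCutoff F Fn) (hg : Continuous g) {n m : ℕ} (hnm : n ≤ m)
    (hb : CutoffBounded Fn g n t) :
    ∀ s ≤ t, picardLimit (Fn n) g s = picardLimit (Fn m) g s := by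
  have hnm' : (n : ℝ) ≤ m := by exact_mod_cast hnm
  exact hc.eq_picardLimit hg (hc.solvesTo_of_norm_le hg fun s hs => by linarith [hb s hs])
    fun s hs => by linarith [hb s hs]

theorem maximalPath_eq (hc : IsCutoff F Fn) (hg : Continuous g) {n : ℕ}
    (hb : CutoffBounded Fn g n t) : ∀ s ≤ t, maximalPath Fn g s = picardLimit (Fn n) g s := by
  intro s hs
  refine (tendsto_const_nhds.congr' ?_ : Tendsto _ atTop (𝓝 _)).limUnder_eq
  filter_upwards [eventually_ge_atTop n] with m hm
  exact hc.picardLimit_eq_of_le hg hm hb s hs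

theorem cutoffBounded_of_norm_le (hc : IsCutoff F Fn) (hg : Continuous g) {u : ℝ≥0 → V} {n : ℕ}
    (hu : SolvesTo F g t u) (hb : ∀ s ≤ t, ‖u s‖ ≤ n) : CutoffBounded Fn g n t := by
  intro s hs
  rw [← hc.eq_picardLimit hg hu (fun s hs => (hb s hs).trans (by linarith)) s hs]
  exact hb s hs

theorem exists_cutoffBounded (hc : IsCutoff F Fn) (hg : Continuous g) {u : ℝ≥0 → V}
    (hu : SolvesTo F g t u) : ∃ n, CutoffBounded Fn g n t := by
  have hcpt : IsCompact (Set.Iic t) := by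
    rw [← Set.Icc_bot]; exact isCompact_Icc
  obtain ⟨C, hC⟩ := hcpt.exists_bound_of_continuousOn hu.continuousOn
  obtain ⟨n, hn⟩ := exists_nat_ge C
  exact ⟨n, hc.cutoffBounded_of_norm_le hg hu fun s hs => (hC s hs).trans hn⟩

/-- The point is that the supremum is not attained. A bound `n` at time `t` persists as `n + 1`
slightly later, and `Fn n` still equals `F` there: this is the reason for the margin between the
radii `n` and `n + 1`. -/
theorem coe_lt_explosionTime_iff (hc : IsCutoff F Fn) (hg : Continuous g) :
    (t : ℝ≥0∞) < explosionTime Fn g ↔ ∃ n, CutoffBounded Fn g n t := by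
  constructor
  · intro h
    obtain ⟨s, hs⟩ := lt_iSup_iff.1 h
    obtain ⟨⟨n, hn⟩, hs⟩ := lt_iSup_iff.1 hs
    exact ⟨n, fun r hr => hn r (hr.trans (ENNReal.coe_lt_coe.1 hs).le)⟩
  · rintro ⟨n, hn⟩
    have hcont := (hc.continuous hg n).norm
    have h1 : ∀ᶠ s in 𝓝 t, ‖picardLimit (Fn n) g s‖ < n + 1 :=
      hcont.continuousAt.eventually_lt continuousAt_const (by linarith [hn t le_rfl])
    obtain ⟨s, hts, hs⟩ := exists_Ico_subset_of_mem_nhds h1 ⟨t + 1, lt_add_one t⟩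
    obtain ⟨s', hts', hs'⟩ := exists_between hts
    have hb : ∀ r ≤ s', ‖picardLimit (Fn n) g r‖ ≤ n + 1 := fun r hr => by
      rcases le_total r t with h | h
      · linarith [hn r h]
      · exact (show _ < _ from hs ⟨h, hr.trans_lt hs'⟩).le
    have hgood : CutoffBounded Fn g (n + 1) s' :=
      hc.cutoffBounded_of_norm_le hg (hc.solvesTo_of_norm_le hg hb)
        fun r hr => by simpa using hb r hr
    exact (ENNReal.coe_lt_coe.2 hts').trans_le
      (le_iSup₂_of_le s' ⟨n + 1, hgood⟩ le_rfl)

theorem solvesTo_maximalPath (hc : IsCutoff F Fn) (hg : Continuous g)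
    (ht : (t : ℝ≥0∞) < explosionTime Fn g) : SolvesTo F g t (maximalPath Fn g) := by
  obtain ⟨n, hn⟩ := (hc.coe_lt_explosionTime_iff hg).1 ht
  exact (hc.solvesTo_of_norm_le hg fun s hs => (hn s hs).trans (by linarith)).congr
    fun s hs => (hc.maximalPath_eq hg hn s hs).symm

/-- The inequality is strict because the solution lives on the closed interval up to `t`. This gives
maximality, positivity of the explosion time, and the contradiction in the case of zero vortices. -/
theorem lt_explosionTime (hc : IsCutoff F Fn) (hg : Continuous g) {u : ℝ≥0 → V}
    (hu : SolvesTo F g t u) : (t : ℝ≥0∞) < explosionTime Fn g :=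
  (hc.coe_lt_explosionTime_iff hg).2 (hc.exists_cutoffBounded hg hu)

theorem eq_maximalPath (hc : IsCutoff F Fn) (hg : Continuous g) {u : ℝ≥0 → V}
    (hu : SolvesTo F g t u) : u t = maximalPath Fn g t := by
  obtain ⟨C, hC⟩ := (Set.Icc_bot (a := t) ▸ isCompact_Icc).exists_bound_of_continuousOn
    hu.continuousOn
  obtain ⟨n, hn⟩ := exists_nat_ge C
  have hb : ∀ s ≤ t, ‖u s‖ ≤ n := fun s hs => (hC s hs).trans hn
  rw [hc.maximalPath_eq hg (hc.cutoffBounded_of_norm_le hg hu hb) t le_rfl,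
    ← hc.eq_picardLimit hg hu (fun s hs => (hb s hs).trans (by linarith)) t le_rfl]

theorem explosionTime_pos (hc : IsCutoff F Fn) (hg : Continuous g) : 0 < explosionTime Fn g := by
  have h : SolvesTo F g 0 g := ⟨hg.continuousOn, fun s hs => by
    obtain rfl : s = 0 := le_antisymm hs zero_le
    simp⟩
  exact_mod_cast hc.lt_explosionTime hg h

/-- Otherwise the path is in the ball of radius `n` at times arbitrarily close to `T`. From a late
enough such time `a`, the forcing moves by less than `1/2` and the drift contributes less than
`1/4`, so radius `n + 1` is never reached before `T`. The path is then bounded on `[0, T)` and can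
be continued past `T`. -/
theorem tendsto_norm_maximalPath (hc : IsCutoff F Fn) (hF : Continuous F)
    (hg : Continuous g) {T : ℝ≥0}
    (hT : explosionTime Fn g = T) :
    Tendsto (fun t => ‖maximalPath Fn g t‖) (𝓝[<] T) atTop := by
  have hTpos : 0 < T := by
    have := hc.explosionTime_pos hg
    rw [hT] at this
    exact_mod_cast this
  have hsol : ∀ t < T, SolvesTo F g t (maximalPath Fn g) := fun t ht =>
    hc.solvesTo_maximalPath hg (by rw [hT]; exact_mod_cast ht)
  set Z := maximalPath Fn g
  by_contra hcon
  obtain ⟨N, hN⟩ := not_forall.1 (fun h => hcon (tendsto_atTop.2 h))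
  obtain ⟨n, hn⟩ := exists_nat_ge N
  obtain ⟨M, hM⟩ := hc.bounded n
  have hM0 : 0 ≤ M := (norm_nonneg _).trans (hM 0)
  have h1 : ∀ᶠ t in 𝓝[<] T, dist (g t) (g T) < 1 / 4 :=
    nhdsWithin_le_nhds (hg.continuousAt.eventually (Metric.ball_mem_nhds _ (by norm_num)))
  have h2 : ∀ᶠ t : ℝ≥0 in 𝓝[<] T, M * ((T : ℝ) - t) < 1 / 4 := by
    refine nhdsWithin_le_nhds (ContinuousAt.eventually_lt (by fun_prop) continuousAt_const ?_)
    simp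
  obtain ⟨l, hl, hlT⟩ := (mem_nhdsLT_iff_exists_mem_Ico_Ioo_subset hTpos).1 (h1.and h2)
  obtain ⟨a, haN, hla, haT⟩ :=
    ((not_eventually.1 hN).and_eventually (Ioo_mem_nhdsLT hl.2)).exists
  have han : ‖Z a‖ < n := (not_le.1 haN).trans_le hn
  obtain ⟨hga, hMa⟩ := hlT ⟨hla, haT⟩
  -- after time `a` the solution cannot leave the ball of radius `n + 1`
  have hball : ∀ t, a ≤ t → t < T → ‖Z t‖ ≤ n + 1 := by
    intro t hat htT
    by_contra! hlt
    have hZc : ContinuousOn (fun s => ‖Z s‖) (Set.Icc a t) :=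
      (hsol t htT).continuousOn.norm.mono fun s hs => hs.2
    -- `s` is the first time after `a` at which the norm reaches `n + 1`; before it the drift is
    -- that of `Fn n`, bounded by `M`.
    obtain ⟨s, ⟨⟨has, hst⟩, hsn⟩, hmin⟩ :=
      (isCompact_Icc.of_isClosed_subset (hZc.preimage_isClosed_of_isClosed isClosed_Icc
        (isClosed_Ici (a := (n : ℝ) + 1))) Set.inter_subset_left).exists_isLeast
        ⟨t, ⟨hat, le_rfl⟩, hlt.le⟩
    have hsn : (n : ℝ) + 1 ≤ ‖Z s‖ := hsn
    have hsT := hst.trans_lt htT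
    have hless : ∀ r, a ≤ r → r < s → ‖Z r‖ < n + 1 := fun r har hrs => by
      by_contra! h
      exact (hmin ⟨⟨har, hrs.le.trans hst⟩, h⟩).not_gt hrs
    have heq : ∀ r ≤ s, Z r = g r + ∫ q in (0 : ℝ)..r, F (Z q.toNNReal) :=
      (hsol s hsT).eq
    have has_ne : a ≠ s := by rintro rfl; linarith
    have has' : (a : ℝ) ≤ s := by exact_mod_cast has
    have hbd : ‖∫ q in (a : ℝ)..s, F (Z q.toNNReal)‖ ≤ M * |(s : ℝ) - a| := by
      refine intervalIntegral.norm_integral_le_of_norm_le_const_ae ?_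
      -- The endpoint `s`, where the strict bound fails, is a null set.
      filter_upwards [compl_mem_ae_iff.2 (measure_singleton (s : ℝ))] with q hqs hq
      rw [Set.uIoc_of_le has'] at hq
      have hq1 : a ≤ q.toNNReal := NNReal.le_toNNReal_of_coe_le hq.1.le
      have hq2 : q.toNNReal < s :=
        (Real.toNNReal_lt_iff_lt_coe (a.2.trans hq.1.le)).2 (lt_of_le_of_ne hq.2 hqs)
      rw [← hc.eq n _ (hless _ hq1 hq2).le]
      exact hM _
    have hi : ∀ r ≤ s, IntervalIntegrable (fun q : ℝ => F (Z q.toNNReal)) volume 0 r := fun r hr =>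
      ContinuousOn.intervalIntegrable_path (p := fun q => F (Z q))
        (hF.comp_continuousOn (hsol s hsT).continuousOn) hr
    have hdiff : Z s - Z a = (g s - g a) + ∫ q in (a : ℝ)..s, F (Z q.toNNReal) := by
      rw [heq s le_rfl, heq a has, ← intervalIntegral.integral_interval_sub_left
        (hi s le_rfl) (hi a has)]
      abel
    have hgs : dist (g s) (g T) < 1 / 4 := (hlT ⟨hla.trans_le has, hsT⟩).1
    have hgas : ‖g s - g a‖ < 1 / 2 := by
      rw [← dist_eq_norm]
      linarith [dist_triangle_right (g s) (g a) (g T)]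
    have hMs : M * |(s : ℝ) - a| < 1 / 4 := by
      rw [abs_of_nonneg (sub_nonneg.2 has')]
      have hsT' : (s : ℝ) ≤ T := by exact_mod_cast hsT.le
      exact (mul_le_mul_of_nonneg_left (by linarith) hM0).trans_lt hMa
    have h3 : ‖Z s - Z a‖ < 3 / 4 := by
      rw [hdiff]
      linarith [norm_add_le (g s - g a) (∫ q in (a : ℝ)..s, F (Z q.toNNReal))]
    linarith [norm_sub_norm_le (Z s) (Z a)]
  obtain ⟨C, hC⟩ := (Set.Icc_bot (a := a) ▸ isCompact_Icc).exists_bound_of_continuousOn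
    (hsol a haT).continuousOn
  obtain ⟨m, hm⟩ := exists_nat_ge (max C (n + 1))
  have hZm : ∀ t < T, ‖Z t‖ ≤ m := fun t ht => by
    rcases le_total t a with h | h
    · exact (hC t h).trans ((le_max_left _ _).trans hm)
    · exact (hball t h ht).trans ((le_max_right _ _).trans hm)
  -- The cut-off solution, unlike `Z`, is known to be continuous at `T`, so its bound passes from
  -- `[0, T)` to the closure.
  have hgood : CutoffBounded Fn g m T := by
    have hclosed : IsClosed {s | ‖picardLimit (Fn m) g s‖ ≤ m} :=
      isClosed_le (hc.continuous hg m).norm continuous_const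
    have hsub : Set.Iio T ⊆ {s | ‖picardLimit (Fn m) g s‖ ≤ m} := fun s hs => by
      have := hc.cutoffBounded_of_norm_le hg (hsol s hs) (n := m)
        fun r hr => hZm r (hr.trans_lt hs)
      exact this s le_rfl
    have h := closure_minimal hsub hclosed
    have hne : (Set.Iio T).Nonempty := ⟨0, hTpos⟩
    rw [closure_Iio' hne] at h
    exact h
  exact ((hc.coe_lt_explosionTime_iff hg).2 ⟨m, hgood⟩).ne hT.symm

end IsCutoff

/-! ### Dependence of the maximal solution on the random parameter -/

section Measurability

variable {Ω : Type*} [MeasurableSpace V] [BorelSpace V]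
  [SecondCountableTopology V]

theorem IsCutoff.measurable_picardLimit (hc : IsCutoff F Fn) {m : MeasurableSpace Ω}
    {g : Ω → ℝ≥0 → V} (hgc : ∀ ω, Continuous (g ω)) (hgm : ∀ s ≤ t, Measurable fun ω => g ω s)
    (n : ℕ) : ∀ s ≤ t, Measurable fun ω => picardLimit (Fn n) (g ω) s := by
  intro s hs
  obtain ⟨L, hL⟩ := hc.lipschitz n
  obtain ⟨M, hM⟩ := hc.bounded n
  exact measurable_of_tendsto_metrizable
    (fun k => measurable_picardIterate hL.continuous hgc hgm k s hs)
    (tendsto_pi_nhds.2 fun ω => tendsto_picardIterate hL hM (hgc ω) s)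

theorem IsCutoff.measurableSet_lt_explosionTime (hc : IsCutoff F Fn) {m : MeasurableSpace Ω}
    {g : Ω → ℝ≥0 → V} (hgc : ∀ ω, Continuous (g ω))
    (hgm : ∀ s ≤ t, Measurable fun ω => g ω s) :
    MeasurableSet {ω | (t : ℝ≥0∞) < explosionTime Fn (g ω)} := by
  -- By continuity the bound for all `s ≤ t` need only be tested on a countable dense set, truncated
  -- at `t` so that no later information is used.
  have h : {ω | (t : ℝ≥0∞) < explosionTime Fn (g ω)} =
      ⋃ n : ℕ, ⋂ k : ℕ,
        {ω | ‖picardLimit (Fn n) (g ω) (min (TopologicalSpace.denseSeq ℝ≥0 k) t)‖ ≤ n} := by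
    ext ω
    simp only [Set.mem_ofPred_eq, Set.mem_iUnion, Set.mem_iInter,
      hc.coe_lt_explosionTime_iff (hgc ω)]
    refine exists_congr fun n => ⟨fun h k => h _ (min_le_right _ _), fun h s hs => ?_⟩
    have hcl : IsClosed {s | ‖picardLimit (Fn n) (g ω) (min s t)‖ ≤ n} :=
      isClosed_le ((hc.continuous (hgc ω) n).comp (by fun_prop)).norm continuous_const
    have := closure_minimal (Set.range_subset_iff.2 h) hcl
      (TopologicalSpace.denseRange_denseSeq ℝ≥0 s)
    simpa only [Set.mem_ofPred_eq, min_eq_left hs] using this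
  rw [h]
  refine .iUnion fun n => .iInter fun k => ?_
  exact measurableSet_le (hc.measurable_picardLimit hgc hgm n _ (min_le_right _ _)).norm
    measurable_const

theorem IsCutoff.measurable_maximalPath (hc : IsCutoff F Fn) {m : MeasurableSpace Ω}
    {g : Ω → ℝ≥0 → V} (hgc : ∀ ω, Continuous (g ω))
    (hgm : ∀ s ≤ t, Measurable fun ω => g ω s) :
    Measurable fun ω => maximalPath Fn (g ω) t :=
  (StronglyMeasurable.limUnder fun n =>
    (hc.measurable_picardLimit hgc hgm n t le_rfl).stronglyMeasurable).measurable

end Measurability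

end MaximalSolution

/-! ### The mollified kernel and the vortex drift: smoothness and bounds -/

section Kernel

variable {K : E3 → E3} {φ : E3 → ℝ}

theorem contDiff_mollifiedKernel (hK : LocallyIntegrable K volume)
    (hφ : ContDiff ℝ (⊤ : ℕ∞) φ) (hsupp : HasCompactSupport φ) :
    ContDiff ℝ (⊤ : ℕ∞) (mollifiedKernel K φ) := by
  refine contDiff_euclidean.2 fun j => ?_
  have hKj : LocallyIntegrable (fun y => K y j) volume := fun y => by
    obtain ⟨s, hs, h⟩ := hK y
    exact ⟨s, hs, (EuclideanSpace.proj (𝕜 := ℝ) j).integrable_comp h⟩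
  have h := hsupp.contDiff_convolution_left (μ := volume) (ContinuousLinearMap.mul ℝ ℝ) hφ hKj
  have heq : (fun x => mollifiedKernel K φ x j)
      = convolution φ (fun y => K y j) (ContinuousLinearMap.mul ℝ ℝ) volume := by
    ext x
    simp only [mollifiedKernel, convolution_def, ContinuousLinearMap.mul_apply', mul_comm]
  rw [heq]
  exact h

/-- The bilinear map `(u, v) ↦ (∑ ε^{ijk} u_j v_k)_i`, i.e. the cross product. -/
noncomputable def leviCross (u v : E3) : E3 :=
  WithLp.toLp 2 fun i => ∑ j, ∑ k, leviCivita i j k * u j * v k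

/-- Lagrange's identity: `|u|²|v|² - |u × v|² = (u · v)² ≥ 0`. The constant `1` here is what makes
the explosion bound come out exactly. -/
theorem norm_leviCross_le (u v : E3) : ‖leviCross u v‖ ≤ ‖u‖ * ‖v‖ := by
  refine abs_le_of_sq_le_sq' ?_ (by positivity) |>.2
  rw [mul_pow, EuclideanSpace.norm_sq_eq, EuclideanSpace.norm_sq_eq, EuclideanSpace.norm_sq_eq]
  simp only [leviCross, leviCivita, Fin.sum_univ_three, Real.norm_eq_abs, sq_abs]
  simp
  nlinarith [sq_nonneg (u 0 * v 0 + u 1 * v 1 + u 2 * v 2)]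

variable {ι : Type*} [Fintype ι]

theorem velocityField_eq (X A : ι → E3) (y : E3) :
    velocityField K φ X A y = -∑ n, leviCross (A n) (mollifiedKernel K φ (y - X n)) := by
  ext i
  simp [velocityField, leviCross]

/-- Expanding `A_n` in the standard basis turns `A_n^l ∂_l K_φ` into the derivative applied to
`A_n`. The operator norm then controls it without dimensional constants. -/
theorem stretching_eq (X A : ι → E3) (n : ι) :
    stretching K φ X A n =
      ∑ m, leviCross (fderiv ℝ (mollifiedKernel K φ) (X n - X m) (A n)) (A m) := by
  have h : ∀ (f : E3 →L[ℝ] E3) (u : E3) (j : Fin 3),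
      f u j = ∑ l, u l * f (EuclideanSpace.single l 1) j := fun f u j => by
    conv_lhs => rw [← (EuclideanSpace.basisFun (Fin 3) ℝ).sum_repr u]
    simp
  ext i
  simp only [stretching, leviCross, mollifiedKernelDeriv, WithLp.ofLp_sum, Finset.sum_apply]
  simp only [h _ (A n), Finset.mul_sum, Finset.sum_mul]
  rw [Finset.sum_comm]
  refine Finset.sum_congr rfl fun m _ => ?_
  rw [Finset.sum_comm]
  refine Finset.sum_congr rfl fun j _ => ?_
  rw [Finset.sum_comm]
  exact Finset.sum_congr rfl fun k _ => Finset.sum_congr rfl fun l _ => by ring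

theorem contDiff_vorticityField (hφ : ContDiff ℝ (⊤ : ℕ∞) φ) (X A : ι → E3) :
    ContDiff ℝ (⊤ : ℕ∞) (vorticityField φ X A) := by
  refine contDiff_euclidean.2 fun i => ?_
  simp only [vorticityField]
  fun_prop

theorem contDiff_leviCross {W : Type*} [NormedAddCommGroup W] [NormedSpace ℝ W] {f g : W → E3}
    {n : WithTop ℕ∞} (hf : ContDiff ℝ n f) (hg : ContDiff ℝ n g) :
    ContDiff ℝ n fun w => leviCross (f w) (g w) := by
  refine contDiff_euclidean.2 fun i => ?_
  have hf' := fun j => contDiff_euclidean.1 hf j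
  have hg' := fun j => contDiff_euclidean.1 hg j
  simp only [leviCross]
  fun_prop

theorem contDiff_velocityField (hk : ContDiff ℝ (⊤ : ℕ∞) (mollifiedKernel K φ)) (X A : ι → E3) :
    ContDiff ℝ (⊤ : ℕ∞) (velocityField K φ X A) := by
  rw [funext (velocityField_eq X A)]
  exact (ContDiff.sum fun n _ => contDiff_leviCross contDiff_const
    (hk.comp (contDiff_id.sub contDiff_const))).neg

/-- The drift of the random vortex system, as a vector field on the phase space. -/
noncomputable def vortexDrift (K : E3 → E3) (φ : E3 → ℝ) (z : (ι → E3) × (ι → E3)) :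
    (ι → E3) × (ι → E3) :=
  (fun n => velocityField K φ z.1 z.2 (z.1 n), fun n => stretching K φ z.1 z.2 n)

theorem contDiff_vortexDrift (hk : ContDiff ℝ (⊤ : ℕ∞) (mollifiedKernel K φ)) :
    ContDiff ℝ (⊤ : ℕ∞) (vortexDrift (ι := ι) K φ) := by
  have hk' : ContDiff ℝ (⊤ : ℕ∞) (fderiv ℝ (mollifiedKernel K φ)) :=
    hk.fderiv_right (by simp)
  have hX : ∀ n : ι, ContDiff ℝ (⊤ : ℕ∞) fun z : (ι → E3) × (ι → E3) => z.1 n := fun n => by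
    fun_prop
  have hA : ∀ n : ι, ContDiff ℝ (⊤ : ℕ∞) fun z : (ι → E3) × (ι → E3) => z.2 n := fun n => by
    fun_prop
  refine ContDiff.prodMk (contDiff_pi.2 fun n => ?_) (contDiff_pi.2 fun n => ?_)
  · simp only [velocityField_eq]
    exact (ContDiff.sum fun m _ => contDiff_leviCross (hA m) (hk.comp ((hX n).sub (hX m)))).neg
  · simp only [stretching_eq]
    exact ContDiff.sum fun m _ => contDiff_leviCross
      ((hk'.comp ((hX n).sub (hX m))).clm_apply (hA n)) (hA m)

theorem norm_velocityField_le (X A : ι → E3) (y : E3) :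
    ‖velocityField K φ X A y‖ ≤ ∑ n, ‖A n‖ * ‖mollifiedKernel K φ (y - X n)‖ := by
  rw [velocityField_eq, norm_neg]
  exact (norm_sum_le _ _).trans (Finset.sum_le_sum fun n _ => norm_leviCross_le _ _)

/-- Each interaction is at most `D |A_n| |A_m|`, and the double sum factors into a square: the
source of the Riccati equation. -/
theorem sum_norm_stretching_le {D : ℝ} (hD : ∀ y, ‖fderiv ℝ (mollifiedKernel K φ) y‖ ≤ D)
    (X A : ι → E3) : ∑ n, ‖stretching K φ X A n‖ ≤ D * (∑ n, ‖A n‖) ^ 2 := by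
  rw [sq, Finset.sum_mul_sum, Finset.mul_sum]
  refine Finset.sum_le_sum fun n _ => ?_
  rw [stretching_eq, Finset.mul_sum]
  refine (norm_sum_le _ _).trans (Finset.sum_le_sum fun m _ => (norm_leviCross_le _ _).trans ?_)
  rw [← mul_assoc]
  gcongr
  exact (ContinuousLinearMap.le_opNorm _ _).trans (by gcongr; exact hD _)

/-- The essential bound holds on a conull set, which is dense, and extends to every point by
continuity. -/
theorem norm_le_toReal_eLpNorm_top {E F : Type*} [NormedAddCommGroup E] [NormedAddCommGroup F]
    [MeasurableSpace E] {μ : Measure E} [μ.IsOpenPosMeasure] {f : E → F} (hf : Continuous f)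
    (h : eLpNorm f ⊤ μ ≠ ⊤) (y : E) : ‖f y‖ ≤ (eLpNorm f ⊤ μ).toReal := by
  have hae : ∀ᵐ y ∂μ, ‖f y‖ ≤ (eLpNorm f ⊤ μ).toReal := by
    rw [eLpNorm_exponent_top] at h ⊢
    filter_upwards [enorm_ae_le_eLpNormEssSup f μ] with y hy
    rw [← toReal_enorm]
    exact ENNReal.toReal_mono h hy
  have hd := Measure.dense_of_ae hae
  exact closure_minimal subset_rfl (isClosed_le hf.norm continuous_const) (hd y)

end Kernel

/-! ### The vortex system as an integral equation -/

section VortexPath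

variable {ι : Type*} {K : E3 → E3} {φ : E3 → ℝ} {ν : ℝ} {x a : ι → E3} {b : ℝ≥0 → E3}

/-- The driving path of the random vortex system: initial values plus noise. -/
noncomputable def vortexForcing (ν : ℝ) (x a : ι → E3) (b : ℝ≥0 → E3) (t : ℝ≥0) :
    (ι → E3) × (ι → E3) :=
  (fun n => x n + √(2 * ν) • (b t - b 0), a)

theorem continuous_vortexForcing (hb : Continuous b) : Continuous (vortexForcing ν x a b) := by
  unfold vortexForcing
  fun_prop

variable [Fintype ι]

theorem integral_fst_apply {p : ℝ≥0 → (ι → E3) × (ι → E3)} {s : ℝ≥0}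
    (hp : ContinuousOn p (Set.Iic s)) (n : ι) :
    (∫ r in (0 : ℝ)..s, p r.toNNReal).1 n = ∫ r in (0 : ℝ)..s, (p r.toNNReal).1 n :=
  (((ContinuousLinearMap.proj n).comp (ContinuousLinearMap.fst ℝ (ι → E3)
    (ι → E3))).intervalIntegral_comp_comm (hp.intervalIntegrable_path le_rfl)).symm

theorem integral_snd_apply {p : ℝ≥0 → (ι → E3) × (ι → E3)} {s : ℝ≥0}
    (hp : ContinuousOn p (Set.Iic s)) (n : ι) :
    (∫ r in (0 : ℝ)..s, p r.toNNReal).2 n = ∫ r in (0 : ℝ)..s, (p r.toNNReal).2 n :=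
  (((ContinuousLinearMap.proj n).comp (ContinuousLinearMap.snd ℝ (ι → E3)
    (ι → E3))).intervalIntegral_comp_comm (hp.intervalIntegrable_path le_rfl)).symm

theorem solvesTo_vortexDrift_iff (hF : Continuous (vortexDrift (ι := ι) K φ)) {t : ℝ≥0}
    {g u : ℝ≥0 → (ι → E3) × (ι → E3)} :
    SolvesTo (vortexDrift K φ) g t u ↔ ContinuousOn u (Set.Iic t) ∧
      (∀ s ≤ t, ∀ n, (u s).1 n = (g s).1 n + ∫ r in (0 : ℝ)..s,
        velocityField K φ (u r.toNNReal).1 (u r.toNNReal).2 ((u r.toNNReal).1 n)) ∧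
      (∀ s ≤ t, ∀ n, (u s).2 n = (g s).2 n + ∫ r in (0 : ℝ)..s,
        stretching K φ (u r.toNNReal).1 (u r.toNNReal).2 n) := by
  have key : ContinuousOn u (Set.Iic t) → ∀ s ≤ t,
      ContinuousOn (fun r => vortexDrift K φ (u r)) (Set.Iic s) := fun h s hs =>
    hF.comp_continuousOn (h.mono (Set.Iic_subset_Iic.2 hs))
  constructor
  · intro h
    refine ⟨h.continuousOn, fun s hs n => ?_, fun s hs n => ?_⟩
    · have := congrArg (fun z => z.1 n) (h.eq s hs)
      simp only [Prod.fst_add, Pi.add_apply, integral_fst_apply (key h.continuousOn s hs)] at this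
      exact this
    · have := congrArg (fun z => z.2 n) (h.eq s hs)
      simp only [Prod.snd_add, Pi.add_apply, integral_snd_apply (key h.continuousOn s hs)] at this
      exact this
  · rintro ⟨hc, h1, h2⟩
    refine ⟨hc, fun s hs => Prod.ext (funext fun n => ?_) (funext fun n => ?_)⟩
    · simp only [Prod.fst_add, Pi.add_apply, integral_fst_apply (key hc s hs)]
      exact h1 s hs n
    · simp only [Prod.snd_add, Pi.add_apply, integral_snd_apply (key hc s hs)]
      exact h2 s hs n

theorem isVortexPath_iff (hF : Continuous (vortexDrift (ι := ι) K φ)) {T : ℝ≥0∞}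
    {X A : ℝ≥0 → ι → E3} :
    IsVortexPath K φ ν x a b T X A ↔ ∀ t : ℝ≥0, (t : ℝ≥0∞) < T →
      SolvesTo (vortexDrift K φ) (vortexForcing ν x a b) t fun s => (X s, A s) := by
  simp only [solvesTo_vortexDrift_iff hF, vortexForcing]
  constructor
  · intro h t ht
    have hs : ∀ s ≤ t, (s : ℝ≥0∞) < T := fun s hs => (ENNReal.coe_le_coe.2 hs).trans_lt ht
    refine ⟨(h.continuousOn_loci.mono hs).prodMk (h.continuousOn_vortices.mono hs),
      fun s hst n => ?_, fun s hst n => h.vortices_eq s (hs s hst) n⟩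
    rw [h.loci_eq s (hs s hst) n]
    abel
  · intro h
    have hopen : IsOpen {t : ℝ≥0 | (t : ℝ≥0∞) < T} :=
      isOpen_lt ENNReal.continuous_coe continuous_const
    have hcont : ContinuousOn (fun s => (X s, A s)) {t : ℝ≥0 | (t : ℝ≥0∞) < T} := fun t ht => by
      -- A time beyond `t` but still below `T` makes the closed interval a neighbourhood of `t`.
      obtain ⟨s, hts, hs⟩ : ∃ s : ℝ≥0, t < s ∧ (s : ℝ≥0∞) < T := by
        obtain ⟨s, h1, h2⟩ := ENNReal.lt_iff_exists_nnreal_btwn.1 ht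
        exact ⟨s, ENNReal.coe_lt_coe.1 h1, h2⟩
      exact ((h s hs).1.continuousAt (Iic_mem_nhds hts)).continuousWithinAt
    refine ⟨hcont.fst, hcont.snd, fun t ht n => ?_, fun t ht n => (h t ht).2.2 t le_rfl n⟩
    rw [(h t ht).2.1 t le_rfl n]
    abel

end VortexPath

/-- Comparison with the Riccati equation `y' = D y²`. -/
theorem le_div_of_le_integral_sq {h : ℝ → ℝ} {c D T : ℝ} (hc : 0 < c) (hD : 0 ≤ D)
    (hh : Continuous h) (h0 : ∀ t, 0 ≤ h t) (hT : D * c * T < 1)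
    (hle : ∀ t ∈ Set.Icc 0 T, h t ≤ c + D * ∫ s in (0 : ℝ)..t, h s ^ 2) :
    ∀ t ∈ Set.Icc 0 T, h t ≤ c / (1 - D * c * T) := by
  intro t ht
  set H : ℝ → ℝ := fun t => c + D * ∫ s in (0 : ℝ)..t, h s ^ 2 with hH
  have hd : ∀ s, HasDerivAt H (D * h s ^ 2) s := fun s =>
    (((hh.pow 2).integral_hasStrictDerivAt 0 s).hasDerivAt.const_mul D).const_add c
  have hHpos : ∀ s ∈ Set.Icc 0 T, c ≤ H s := fun s hs => by
    have : 0 ≤ ∫ r in (0 : ℝ)..s, h r ^ 2 :=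
      intervalIntegral.integral_nonneg hs.1 fun r _ => sq_nonneg _
    simp only [hH]
    nlinarith
  -- Since `H' = D h² ≤ D H²`, the derivative `-H'/H² + D` of `1/H + D s` is nonnegative.
  have hmono : MonotoneOn (fun s => (H s)⁻¹ + D * s) (Set.Icc 0 T) := by
    have hd' : ∀ s ∈ Set.Icc 0 T, HasDerivAt (fun s => (H s)⁻¹ + D * s)
        (-(D * h s ^ 2) / H s ^ 2 + D * 1) s := fun s hs =>
      ((hd s).inv (hc.trans_le (hHpos s hs)).ne').add ((hasDerivAt_id s).const_mul D)
    refine monotoneOn_of_deriv_nonneg (convex_Icc 0 T)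
      (fun s hs => (hd' s hs).continuousAt.continuousWithinAt)
      (fun s hs => (hd' s (interior_subset hs)).differentiableAt.differentiableWithinAt)
      fun s hs => ?_
    have hs' := interior_subset hs
    rw [(hd' s hs').deriv, neg_div, mul_one, neg_add_eq_sub, sub_nonneg,
      div_le_iff₀ (pow_pos (hc.trans_le (hHpos s hs')) 2)]
    exact mul_le_mul_of_nonneg_left (pow_le_pow_left₀ (h0 s) (hle s hs') 2) hD
  have h1 : c⁻¹ ≤ (H t)⁻¹ + D * t := by
    simpa [hH] using hmono ⟨le_rfl, ht.1.trans ht.2⟩ ht ht.1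
  have hHt := hc.trans_le (hHpos t ht)
  have h2 : c⁻¹ - D * T ≤ (H t)⁻¹ := by
    linarith [mul_le_mul_of_nonneg_left ht.2 hD]
  have h3 : c⁻¹ - D * T = (1 - D * c * T) / c := by field_simp
  rw [h3, div_le_iff₀ hc, inv_mul_eq_div, le_div_iff₀ hHt] at h2
  refine (hle t ht).trans ?_
  rw [le_div_iff₀ (by linarith)]
  linarith

/-! ### A priori bounds and the lower bound for the explosion time -/

section VortexBound

variable {ι : Type*} [Fintype ι] {K : E3 → E3} {φ : E3 → ℝ} {D : ℝ} {t : ℝ≥0}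

theorem norm_mollifiedKernel_le (hk : Differentiable ℝ (mollifiedKernel K φ))
    (hD : ∀ y, ‖fderiv ℝ (mollifiedKernel K φ) y‖ ≤ D) (y : E3) :
    ‖mollifiedKernel K φ y‖ ≤ ‖mollifiedKernel K φ 0‖ + D * ‖y‖ := by
  have h := convex_univ.norm_image_sub_le_of_norm_fderiv_le (𝕜 := ℝ) (fun y _ => hk y)
    (fun y _ => hD y) (Set.mem_univ 0) (Set.mem_univ y)
  rw [sub_zero] at h
  linarith [norm_le_insert' (mollifiedKernel K φ y) (mollifiedKernel K φ 0)]

/-- The Riccati comparison applies to `∑ |A_n|`. The bound is stated with `T` rather than `t` so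
that it is uniform as `t` approaches `T`. -/
theorem sum_norm_vortices_le (hF : Continuous (vortexDrift (ι := ι) K φ))
    (hD : ∀ y, ‖fderiv ℝ (mollifiedKernel K φ) y‖ ≤ D) {g u : ℝ≥0 → (ι → E3) × (ι → E3)}
    {c T : ℝ} (hc : 0 < c) (hg : ∀ s, ∑ n, ‖(g s).2 n‖ ≤ c) (hT : D * c * T < 1) (ht : t ≤ T)
    (hu : SolvesTo (vortexDrift K φ) g t u) :
    ∀ s ≤ t, ∑ n, ‖(u s).2 n‖ ≤ c / (1 - D * c * T) := by
  have hD0 : 0 ≤ D := (norm_nonneg _).trans (hD 0)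
  set h : ℝ≥0 → ℝ := fun s => ∑ n, ‖(u s).2 n‖
  have hhc : ContinuousOn h (Set.Iic t) :=
    continuousOn_finsetSum _ fun n _ =>
      ((continuous_apply n).comp_continuousOn hu.continuousOn.snd).norm
  have hT' : D * c * t < 1 := (mul_le_mul_of_nonneg_left ht (by positivity)).trans_lt hT
  have key := le_div_of_le_integral_sq (h := fun r : ℝ => h (min r.toNNReal t)) (T := t) hc hD0
    (hhc.comp_min.comp continuous_real_toNNReal)
    (fun r => Finset.sum_nonneg fun n _ => norm_nonneg _) hT' (by
      rintro r ⟨hr0, hrt⟩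
      lift r to ℝ≥0 using hr0
      have hrt : r ≤ t := by exact_mod_cast hrt
      have hint : ∫ s in (0 : ℝ)..r, h (min s.toNNReal t) ^ 2
          = ∫ s in (0 : ℝ)..r, h s.toNNReal ^ 2 :=
        integral_congr_path (p := fun s => h (min s t) ^ 2) (q := fun s => h s ^ 2)
          fun s hs => by rw [min_eq_left (hs.trans hrt)]
      have hstr : ∀ n, ContinuousOn (fun s => ‖stretching K φ (u s).1 (u s).2 n‖)
          (Set.Iic t) := fun n =>
        ((continuous_apply n).comp_continuousOn (hF.comp_continuousOn hu.continuousOn).snd).norm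
      rw [Real.toNNReal_coe, min_eq_left hrt, hint, ← intervalIntegral.integral_const_mul]
      calc h r ≤ ∑ n, (‖(g r).2 n‖
            + ∫ s in (0 : ℝ)..r, ‖stretching K φ (u s.toNNReal).1 (u s.toNNReal).2 n‖) := by
            refine Finset.sum_le_sum fun n _ => ?_
            rw [((solvesTo_vortexDrift_iff hF).1 hu).2.2 r hrt n]
            refine (norm_add_le _ _).trans ?_
            gcongr
            exact intervalIntegral.norm_integral_le_integral_norm r.coe_nonneg
        _ ≤ c + ∫ s in (0 : ℝ)..r,
              ∑ n, ‖stretching K φ (u s.toNNReal).1 (u s.toNNReal).2 n‖ := by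
            rw [Finset.sum_add_distrib, intervalIntegral.integral_finsetSum
              fun n _ => (hstr n).intervalIntegrable_path hrt]
            gcongr
            exact hg r
        _ ≤ _ := by
            gcongr
            refine intervalIntegral.integral_mono_on r.coe_nonneg
              ((continuousOn_finsetSum _ fun n _ => hstr n).intervalIntegrable_path hrt)
              (((hhc.pow 2).intervalIntegrable_path hrt).const_mul D) fun s _ => ?_
            exact sum_norm_stretching_le hD _ _)
  intro s hs
  have := key s ⟨s.2, by exact_mod_cast hs⟩
  simp only [Real.toNNReal_coe, min_eq_left hs] at this
  refine this.trans (div_le_div_of_nonneg_left hc.le (by linarith) ?_)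
  linarith [mul_le_mul_of_nonneg_left ht (by positivity : 0 ≤ D * c)]

/-- As long as the vortices stay bounded, so do the loci. -/
theorem norm_loci_le (hF : Continuous (vortexDrift (ι := ι) K φ))
    (hk : Differentiable ℝ (mollifiedKernel K φ))
    (hD : ∀ y, ‖fderiv ℝ (mollifiedKernel K φ) y‖ ≤ D) {g u : ℝ≥0 → (ι → E3) × (ι → E3)}
    {G R T : ℝ} (hR : 0 ≤ R) (hg : ∀ s ≤ t, ‖(g s).1‖ ≤ G) (ht : t ≤ T)
    (hu : SolvesTo (vortexDrift K φ) g t u) (hA : ∀ s ≤ t, ∑ n, ‖(u s).2 n‖ ≤ R) :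
    ‖(u t).1‖ ≤ (G + R * ‖mollifiedKernel K φ 0‖ * T) * Real.exp (2 * R * D * T) := by
  have hD0 : 0 ≤ D := (norm_nonneg _).trans (hD 0)
  have hG0 : 0 ≤ G := (norm_nonneg _).trans (hg t le_rfl)
  have hT0 : 0 ≤ T := t.coe_nonneg.trans ht
  set k := ‖mollifiedKernel K φ 0‖
  set h : ℝ≥0 → ℝ := fun s => ‖(u s).1‖
  have hhc : ContinuousOn h (Set.Iic t) := hu.continuousOn.fst.norm
  -- A bounded derivative gives `K_φ` linear growth, and two loci differ by at most `2 h`; with the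
  -- vortices bounded by `R`, the velocity is affine in `h`.
  have hV : ∀ s ≤ t, ∀ n, ‖velocityField K φ (u s).1 (u s).2 ((u s).1 n)‖
      ≤ R * k + 2 * R * D * h s := by
    intro s hs n
    refine (norm_velocityField_le _ _ _).trans ?_
    have h1 : ∀ m, ‖mollifiedKernel K φ ((u s).1 n - (u s).1 m)‖ ≤ k + D * (2 * h s) := by
      intro m
      refine (norm_mollifiedKernel_le hk hD _).trans ?_
      gcongr
      refine (norm_sub_le _ _).trans ?_
      linarith [norm_le_pi_norm (u s).1 n, norm_le_pi_norm (u s).1 m]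
    calc _ ≤ ∑ m, ‖(u s).2 m‖ * (k + D * (2 * h s)) :=
          Finset.sum_le_sum fun m _ => mul_le_mul_of_nonneg_left (h1 m) (norm_nonneg _)
      _ ≤ R * (k + D * (2 * h s)) := by
          rw [← Finset.sum_mul]
          exact mul_le_mul_of_nonneg_right (hA s hs) (by positivity)
      _ = _ := by ring
  have key := le_mul_exp_of_le_integral (h := fun r : ℝ => h (min r.toNNReal t))
    (C := G + R * k * T) (L := 2 * R * D) (T := t) (by positivity)
    (hhc.comp_min.comp continuous_real_toNNReal) (by
      rintro r ⟨hr0, hrt⟩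
      lift r to ℝ≥0 using hr0
      have hrt : r ≤ t := by exact_mod_cast hrt
      have hrT : (r : ℝ) ≤ T := le_trans (by exact_mod_cast hrt) ht
      have hint : ∫ s in (0 : ℝ)..r, h (min s.toNNReal t) = ∫ s in (0 : ℝ)..r, h s.toNNReal :=
        integral_congr_path (p := fun s => h (min s t)) (q := h)
          fun s hs => by rw [min_eq_left (hs.trans hrt)]
      have hi := hhc.intervalIntegrable_path hrt
      have hbd : ∫ s in (0 : ℝ)..r, (R * k + 2 * R * D * h s.toNNReal)
          = R * k * r + 2 * R * D * ∫ s in (0 : ℝ)..r, h s.toNNReal := by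
        rw [intervalIntegral.integral_add intervalIntegrable_const (hi.const_mul _),
          intervalIntegral.integral_const, intervalIntegral.integral_const_mul]
        simp [mul_comm]
      have hint0 : 0 ≤ ∫ s in (0 : ℝ)..r, h s.toNNReal :=
        intervalIntegral.integral_nonneg r.coe_nonneg fun s _ => norm_nonneg _
      rw [Real.toNNReal_coe, min_eq_left hrt, hint]
      refine (pi_norm_le_iff_of_nonneg (by positivity)).2 fun n => ?_
      rw [((solvesTo_vortexDrift_iff hF).1 hu).2.1 r hrt n]
      refine (norm_add_le _ _).trans ?_
      have h2 : ‖∫ s in (0 : ℝ)..r, velocityField K φ (u s.toNNReal).1 (u s.toNNReal).2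
          ((u s.toNNReal).1 n)‖ ≤ ∫ s in (0 : ℝ)..r, (R * k + 2 * R * D * h s.toNNReal) := by
        refine intervalIntegral.norm_integral_le_of_norm_le r.coe_nonneg
          (ae_of_all _ fun s hs => ?_) (intervalIntegrable_const.add (hi.const_mul _))
        exact hV _ ((Real.toNNReal_le_iff_le_coe.2 hs.2).trans hrt) n
      have h3 := (norm_le_pi_norm (g r).1 n).trans (hg r hrt)
      have h4 : R * k * r ≤ R * k * T := mul_le_mul_of_nonneg_left hrT (by positivity)
      linarith)
  have := key t ⟨t.2, le_rfl⟩
  simp only [Real.toNNReal_coe, min_self] at this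
  refine this.trans ?_
  gcongr

theorem vortexDrift_eq_zero (X : ι → E3) : vortexDrift K φ (X, 0) = 0 := by
  refine Prod.ext (funext fun n => ?_) (funext fun n => ?_)
  · ext i
    simp [vortexDrift, velocityField]
  · ext i
    simp [vortexDrift, stretching]

theorem explosionBound_pos {a : ι → E3}
    (h : eLpNorm (fderiv ℝ (mollifiedKernel K φ)) ⊤ volume ≠ ⊤) : 0 < explosionBound K φ a :=
  ENNReal.div_pos one_ne_zero (ENNReal.mul_ne_top ENNReal.ofReal_ne_top h)

/-- If the explosion time `T` were smaller than the bound, then `D c T < 1` when `a ≠ 0`. Vortices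
and loci would stay bounded up to `T`, against the blow-up of the norm. -/
theorem explosionBound_le_explosionTime {Fn : ℕ → (ι → E3) × (ι → E3) → (ι → E3) × (ι → E3)}
    (hk : ContDiff ℝ (⊤ : ℕ∞) (mollifiedKernel K φ)) (hc : IsCutoff (vortexDrift K φ) Fn)
    {ν : ℝ} {x a : ι → E3} {b : ℝ≥0 → E3} (hb : Continuous b) :
    explosionBound K φ a ≤ explosionTime Fn (vortexForcing ν x a b) := by
  have hF : Continuous (vortexDrift (ι := ι) K φ) := (contDiff_vortexDrift hk).continuous
  have hg : Continuous (vortexForcing ν x a b) := continuous_vortexForcing hb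
  by_contra! hlt
  set c := ∑ n, ‖a n‖ with hcdef
  obtain ⟨T, hT⟩ : ∃ T : ℝ≥0, explosionTime Fn (vortexForcing ν x a b) = T :=
    ⟨_, (ENNReal.coe_toNNReal hlt.ne_top).symm⟩
  have hTpos : 0 < T := by
    have := hc.explosionTime_pos hg
    rw [hT] at this
    exact_mod_cast this
  -- The Riccati comparison needs `c > 0`. With zero vortices the drift vanishes and the forcing
  -- itself is a solution for all time.
  by_cases ha : a = 0
  · have hsol : SolvesTo (vortexDrift K φ) (vortexForcing ν x a b) T (vortexForcing ν x a b) :=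
      ⟨hg.continuousOn, fun s _ => by simp [vortexForcing, ha, vortexDrift_eq_zero]⟩
    exact (hc.lt_explosionTime hg hsol).ne hT.symm
  have hcpos : 0 < c := by
    obtain ⟨n, hn⟩ := Function.ne_iff.1 ha
    exact Finset.sum_pos' (fun n _ => norm_nonneg _) ⟨n, Finset.mem_univ n, norm_pos_iff.2 hn⟩
  rw [hT, explosionBound] at hlt
  set N := eLpNorm (fderiv ℝ (mollifiedKernel K φ)) ⊤ volume
  -- An infinite derivative norm would make the explosion bound `0`, below which no `T` can lie.
  have hN : N ≠ ⊤ := by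
    intro h
    rw [h, ENNReal.mul_top (by simpa using hcpos), ENNReal.div_top] at hlt
    exact not_lt_zero hlt
  have hD := norm_le_toReal_eLpNorm_top (μ := volume)
    (hk.continuous_fderiv (by simp)) hN
  set D := N.toReal
  have hDT : D * c * T < 1 := by
    have h1 := ENNReal.mul_lt_of_lt_div hlt
    have h2 := (ENNReal.toReal_lt_toReal h1.ne_top ENNReal.one_ne_top).2 h1
    rw [ENNReal.toReal_mul, ENNReal.toReal_mul, ENNReal.toReal_ofReal hcpos.le,
      ENNReal.coe_toReal, ENNReal.toReal_one] at h2
    linarith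
  obtain ⟨G, hG⟩ := (Set.Icc_bot (a := T) ▸ isCompact_Icc).exists_bound_of_continuousOn
    hg.continuousOn
  set R := c / (1 - D * c * T)
  have hR : 0 ≤ R := div_nonneg hcpos.le (by linarith)
  set B := max ((G + R * ‖mollifiedKernel K φ 0‖ * T) * Real.exp (2 * R * D * T)) R
  set Z := maximalPath Fn (vortexForcing ν x a b)
  have hbd : ∀ t < T, ‖Z t‖ ≤ B := by
    intro t ht
    have ht' : (t : ℝ) ≤ T := by exact_mod_cast ht.le
    have hsol := hc.solvesTo_maximalPath hg (t := t) (by rw [hT]; exact_mod_cast ht)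
    have hg2 : ∀ s, ∑ n, ‖(vortexForcing ν x a b s).2 n‖ ≤ c := fun s => by
      simp only [vortexForcing, hcdef, le_refl]
    have hA : ∀ s ≤ t, ∑ n, ‖(Z s).2 n‖ ≤ R :=
      sum_norm_vortices_le hF hD hcpos hg2 hDT ht' hsol
    have hG' : ∀ s ≤ t, ‖(vortexForcing ν x a b s).1‖ ≤ G := fun s hs =>
      (norm_fst_le _).trans (hG s (hs.trans ht.le))
    have hX := norm_loci_le hF (hk.differentiable (by simp)) hD hR hG' ht' hsol hA
    rw [Prod.norm_def]
    refine max_le_max hX ?_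
    rw [pi_norm_le_iff_of_nonneg hR]
    intro n
    refine le_trans ?_ (hA t le_rfl)
    exact Finset.single_le_sum (f := fun n => ‖(Z t).2 n‖)
      (fun n _ => norm_nonneg _) (Finset.mem_univ n)
  have hev := (hc.tendsto_norm_maximalPath hF hg hT).eventually_gt_atTop B
  have : (𝓝[<] T).NeBot := nhdsLT_neBot_of_exists_lt ⟨0, hTpos⟩
  obtain ⟨t, ht1, ht2⟩ := (hev.and self_mem_nhdsWithin).exists
  exact (hbd t ht2).not_gt ht1

end VortexBound

theorem measurable_vortexForcing {Ω ι : Type*} {m : MeasurableSpace Ω} {ν : ℝ} {x a : ι → E3}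
    {b : ℝ≥0 → Ω → E3} {t : ℝ≥0} (ht : Measurable (b t)) (h0 : Measurable (b 0)) :
    Measurable fun ω => vortexForcing ν x a (fun t => b t ω) t := by
  unfold vortexForcing
  refine Measurable.prodMk ?_ measurable_const
  rw [measurable_pi_iff]
  intro n
  exact ((ht.sub h0).const_smul (√(2 * ν))).const_add (x n)

/-! ### Continuous adapted version of the Brownian motion -/

section Brownian

variable {Ω : Type*} {mΩ : MeasurableSpace Ω} {P : Measure Ω} {B : ℝ≥0 → Ω → E3}

theorem IsBrownian3.ae_continuous (hB : IsBrownian3 B P) :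
    ∀ᵐ ω ∂P, Continuous fun t => B t ω := by
  filter_upwards [ae_all_iff.2 fun i => (hB.brownian i).cont] with ω h
  exact (PiLp.continuous_toLp 2 _).comp (continuous_pi h)

/-- The Brownian motion is indistinguishable from a process with continuous paths, adapted to the
augmented filtration. -/
theorem IsBrownian3.exists_continuous_modification (hB : IsBrownian3 B P) :
    ∃ b : ℝ≥0 → Ω → E3, (∀ ω, Continuous fun t => b t ω) ∧
      Adapted (brownianFiltration B P hB.measurable) b ∧ ∀ᵐ ω ∂P, ∀ t, b t ω = B t ω := by
  -- The discontinuous paths lie in a measurable null event `N`. It belongs to every σ-algebra of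
  -- the augmented filtration, so setting the process to `0` on `N` preserves adaptedness.
  obtain ⟨N, hsub, hNm, hN⟩ := exists_measurable_superset_of_null (ae_iff.1 hB.ae_continuous)
  refine ⟨fun t => Nᶜ.indicator (B t), fun ω => ?_, fun t => ?_, ?_⟩
  · by_cases hω : ω ∈ N
    · simpa [hω] using continuous_const
    · simpa [hω] using not_not.1 fun h => hω (hsub h)
  · have hBt : Measurable[brownianFiltration B P hB.measurable t] (B t) := by
      refine Measurable.mono (comap_measurable (B t)) ?_ le_rfl
      exact (le_iSup₂_of_le (f := fun s (_ : s ≤ t) =>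
        MeasurableSpace.comap (B s) inferInstance) t le_rfl le_rfl).trans le_sup_left
    have hNt : MeasurableSet[brownianFiltration B P hB.measurable t] N := by
      have h : MeasurableSpace.generateFrom {N | MeasurableSet N ∧ P N = 0}
          ≤ brownianFiltration B P hB.measurable t := le_sup_right
      exact h _ (MeasurableSpace.measurableSet_generateFrom ⟨hNm, hN⟩)
    exact hBt.indicator hNt.compl
  · filter_upwards [compl_mem_ae_iff.2 hN] with ω hω t
    exact Set.indicator_of_mem hω _

end Brownian

/-! ### The random vortex system: the pathwise theory applied to Brownian paths -/

theorem mainTheorem5 {Ω : Type*} {mΩ : MeasurableSpace Ω} (P : Measure Ω) [IsProbabilityMeasure P]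
    (B : ℝ≥0 → Ω → E3) (hB : IsBrownian3 B P)
    (K : E3 → E3) (hK : LocallyIntegrable K volume)
    (φ : E3 → ℝ) (hφ : ContDiff ℝ (⊤ : ℕ∞) φ) (hφ_nonneg : ∀ y, 0 ≤ φ y)
    (r : ℝ) (hr : 0 < r) (hφ_supp : tsupport φ ⊆ Metric.closedBall 0 r)
    (hφ_mass : ∫ y, φ y = 1)
    (ν : ℝ) (hν : 0 ≤ ν) {ι : Type*} [Fintype ι] (x a : ι → E3) :
    ∃ (τ : Ω → ℝ≥0∞) (X A : ℝ≥0 → Ω → ι → E3),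
      -- `(X, A)` is a strong solution up to `τ > 0`
      IsStrongVortexSolution K φ ν x a B P hB τ X A ∧
      (∀ᵐ ω ∂P, 0 < τ ω) ∧
      -- `τ` is the explosion time
      (∀ᵐ ω ∂P, τ ω ≠ ⊤ →
        Tendsto (fun t : ℝ≥0 => (X t ω, A t ω)) (𝓝[<] (τ ω).toNNReal)
          (cocompact ((ι → E3) × (ι → E3)))) ∧
      -- maximality and uniqueness: every solution driven by `B`, up to any random time,
      -- is a restriction of `(X, A)`
      (∀ (σ : Ω → ℝ≥0∞) (Y C : ℝ≥0 → Ω → ι → E3),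
        (∀ᵐ ω ∂P, IsVortexPath K φ ν x a (fun t => B t ω) (σ ω)
          (fun t => Y t ω) (fun t => C t ω)) →
        ∀ᵐ ω ∂P, σ ω ≤ τ ω ∧
          ∀ t : ℝ≥0, (t : ℝ≥0∞) < σ ω → Y t ω = X t ω ∧ C t ω = A t ω) ∧
      -- smoothness of the fields in the space variable before explosion
      (∀ ω, ∀ t : ℝ≥0, (t : ℝ≥0∞) < τ ω →
        ContDiff ℝ (⊤ : ℕ∞) (vorticityField φ (X t ω) (A t ω)) ∧
        ContDiff ℝ (⊤ : ℕ∞) (velocityField K φ (X t ω) (A t ω))) ∧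
      -- the deterministic lower bound for the explosion time
      (∀ᵐ ω ∂P, explosionBound K φ a ≤ τ ω) ∧
      (eLpNorm (fderiv ℝ (mollifiedKernel K φ)) ⊤ volume ≠ ⊤ → 0 < explosionBound K φ a) := by
  have hsupp : HasCompactSupport φ :=
    (isCompact_closedBall 0 r).of_isClosed_subset (isClosed_tsupport φ) hφ_supp
  have hk := contDiff_mollifiedKernel hK hφ hsupp
  have hF := contDiff_vortexDrift (ι := ι) hk
  obtain ⟨Fn, hc⟩ := exists_isCutoff (hF.of_le (by exact_mod_cast le_top) :
    ContDiff ℝ 1 (vortexDrift (ι := ι) K φ))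
  obtain ⟨b, hbc, hbm, hbB⟩ := hB.exists_continuous_modification
  -- The forcing uses the everywhere continuous version `b`, so the pathwise theory holds for every
  -- `ω`. Null events enter only when `b` is replaced by `B`, or through a competing solution.
  set g : Ω → ℝ≥0 → (ι → E3) × (ι → E3) := fun ω => vortexForcing ν x a fun t => b t ω with hgdef
  have hgc : ∀ ω, Continuous (g ω) := fun ω => continuous_vortexForcing (hbc ω)
  have hgm : ∀ t, ∀ s ≤ t,
      Measurable[brownianFiltration B P hB.measurable t] fun ω => g ω s := by
    intro t s hs
    have h1 : ∀ s ≤ t, Measurable[brownianFiltration B P hB.measurable t] (b s) :=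
      fun s hs => (hbm s).mono ((brownianFiltration B P hB.measurable).mono hs) le_rfl
    exact measurable_vortexForcing (h1 s hs) (h1 0 zero_le)
  have hgB : ∀ᵐ ω ∂P, g ω = vortexForcing ν x a fun t => B t ω := by
    filter_upwards [hbB] with ω hω
    simp only [hgdef, hω]
  set τ : Ω → ℝ≥0∞ := fun ω => explosionTime Fn (g ω)
  set Z : ℝ≥0 → Ω → (ι → E3) × (ι → E3) := fun t ω => maximalPath Fn (g ω) t
  have hZm : ∀ t, Measurable[brownianFiltration B P hB.measurable t] (Z t) := fun t =>
    hc.measurable_maximalPath hgc (hgm t)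
  refine ⟨τ, fun t ω => (Z t ω).1, fun t ω => (Z t ω).2, ⟨fun t => ?_, fun t => (hZm t).fst,
    fun t => (hZm t).snd, ?_⟩, ae_of_all _ fun ω => hc.explosionTime_pos (hgc ω),
    ae_of_all _ fun ω hω => ?_, fun σ Y C hYC => ?_, fun ω t _ =>
      ⟨contDiff_vorticityField hφ _ _, contDiff_velocityField hk _ _⟩,
    ae_of_all _ fun ω => explosionBound_le_explosionTime hk hc (hbc ω), explosionBound_pos⟩
  -- The event `{τ ≤ t}` is the complement of `{t < τ}`, which is decided by the forcing up to `t`.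
  · have h := (hc.measurableSet_lt_explosionTime hgc (hgm t)).compl
    convert h using 1
    ext ω
    simp only [Set.mem_ofPred_eq, Set.mem_compl_iff, not_lt]
    rfl
  · filter_upwards [hgB] with ω hω
    refine (isVortexPath_iff hF.continuous).2 fun t ht => ?_
    rw [← hω]
    exact hc.solvesTo_maximalPath (hgc ω) ht
  -- The phase space is finite-dimensional, hence proper: leaving every compact set means that the
  -- norm tends to infinity.
  · rw [← Metric.cobounded_eq_cocompact, ← tendsto_norm_atTop_iff_cobounded]
    exact hc.tendsto_norm_maximalPath hF.continuous (hgc ω) (ENNReal.coe_toNNReal hω).symm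
  · filter_upwards [hYC, hgB] with ω hω hgω
    -- Uniqueness is pathwise, so neither measurability nor adaptedness of `σ`, `Y`, `C` plays a
    -- role.
    have hsol : ∀ t : ℝ≥0, (t : ℝ≥0∞) < σ ω →
        SolvesTo (vortexDrift K φ) (g ω) t fun s => (Y s ω, C s ω) := fun t ht => by
      rw [hgω]
      exact (isVortexPath_iff hF.continuous).1 hω t ht
    refine ⟨ENNReal.le_of_forall_nnreal_lt fun t ht =>
      (hc.lt_explosionTime (hgc ω) (hsol t ht)).le, fun t ht => ?_⟩
    exact Prod.mk.inj (hc.eq_maximalPath (hgc ω) (hsol t ht))
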